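/- All graphs are finite and simple. The claw is $K_{1,3}$, and the co-diamond is the graph with four vertices and exactly one edge (the complement of $K_4$ minus an edge). A graph is $(H_1,H_2)$-free if it has no induced subgraph isomorphic to $H_1$ or to $H_2$. The chromatic symmetric function of a graph $G$ with vertex set $V$ is $X_G=\sum_{\kappa}\prod_{v\in V}x_{\kappa(v)}$, the sum over all proper colorings $\kappa:V\to\{1,2,3,\dots\}$ of $G$ (adjacent vertices get different colors). For $k\ge 0$ let $e_k=\sum_{j_1<\cdots<j_k}x_{j_1}\cdots x_{j_k}$, and let $e_\lambda=e_{\lambda_1}e_{\lambda_2}\cdots e_{\lambda_\ell}$ for a partition $\lambda=(\lambda_1,\dots,\lambda_\ell)$. A graph $G$ is $e$-positive if $X_G$ is a finite linear combination of the functions $e_\lambda$ with nonnegative rational coefficients. Let $\alpha$ denote the largest size of a set of pairwise non-adjacent vertices. **Lemma.** Let $G$ be a (claw, co-diamond)-free graph that is disconnected. Then $G$ is $e$-positive. Moreover, either every connected component of $G$ is a clique, or $G$ is the disjoint union of a complete multipartite graph $M$ with $\alpha(M)\le 2$ and an isolated vertex $K_1$ (the two cases need not exclude each other). -/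

import Mathlib

/-- `G` is `H`-free: no induced subgraph of `G` is isomorphic to `H`. -/
def InducedFree {W V : Type*} (H : SimpleGraph W) (G : SimpleGraph V) : Prop :=
  ¬ H.IsIndContained G

/-- The claw `K_{1,3}`. -/
abbrev claw : SimpleGraph (Fin 1 ⊕ Fin 3) := completeBipartiteGraph (Fin 1) (Fin 3)

/-- The diamond: `K₄` minus one edge. -/
def diamond : SimpleGraph (Fin 4) := (⊤ : SimpleGraph (Fin 4)).deleteEdges {s(2, 3)}

/-- The co-diamond: the complement of the diamond, i.e. four vertices and exactly one edge. -/
def coDiamond : SimpleGraph (Fin 4) := diamondᶜ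

theorem coDiamond_eq : coDiamond = SimpleGraph.edge 2 3 := by
  ext a b
  revert a b
  simp [coDiamond, diamond, SimpleGraph.edge_adj]
  decide

/-- The exponent vector of the monomial `∏ v, x_{κ v}` of a coloring `κ` by positive integers. -/
noncomputable def colorContent {V : Type*} [Fintype V] (κ : V → ℕ+) : ℕ+ →₀ ℕ :=
  ∑ v, Finsupp.single (κ v) 1

/-- Only finitely many colorings have a given monomial, so that the sum defining the chromatic
symmetric function makes sense coefficient by coefficient. -/
theorem finite_colorContent_eq {V : Type*} [Fintype V] (G : SimpleGraph V) (d : ℕ+ →₀ ℕ) :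
    Finite {κ : G.Coloring ℕ+ // colorContent κ = d} := by
  classical
  have key : ∀ κ : {κ : G.Coloring ℕ+ // colorContent κ = d}, ∀ v, κ.1 v ∈ d.support := by
    rintro ⟨κ, rfl⟩ v
    have h : Finsupp.single (κ v) 1 ≤ colorContent κ :=
      Finset.single_le_sum (f := fun v => Finsupp.single (κ v) 1)
        (fun _ _ => zero_le) (Finset.mem_univ v)
    have h1 := h (κ v)
    simp only [Finsupp.single_eq_same] at h1
    exact Finsupp.mem_support_iff.2 (by lia)
  refine Finite.of_injective
    (fun κ : {κ : G.Coloring ℕ+ // colorContent κ = d} =>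
      (fun v => (⟨κ.1 v, key κ v⟩ : d.support) : V → d.support)) ?_
  intro κ κ' h
  apply Subtype.ext
  apply DFunLike.ext
  intro v
  exact congrArg Subtype.val (congrFun h v)

/-- The chromatic symmetric function `X_G = ∑_κ ∏_v x_{κ(v)}`, a formal power series in
`x_1, x_2, …`, where `κ` runs over the proper colorings of `G` by positive integers: the coefficient
of a monomial is the (finite) number of proper colorings `κ` with this monomial. -/
noncomputable def chromaticSymmetricFunction {V : Type*} [Fintype V] (G : SimpleGraph V) :
    MvPowerSeries ℕ+ ℚ :=
  fun d => (Nat.card {κ : G.Coloring ℕ+ // colorContent κ = d} : ℚ)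

open Classical in
/-- The elementary symmetric function `e_k = ∑_{j_1 < ⋯ < j_k} x_{j_1} ⋯ x_{j_k}`: the sum of all
square-free monomials of degree `k` in `x_1, x_2, …`. -/
noncomputable def elemSymm (k : ℕ) : MvPowerSeries ℕ+ ℚ :=
  fun d => if d.degree = k ∧ ∀ i, d i ≤ 1 then 1 else 0

/-- `e_λ = e_{λ_1} e_{λ_2} ⋯ e_{λ_ℓ}` for a partition `λ`. -/
noncomputable def elemSymmPart {n : ℕ} (l : n.Partition) : MvPowerSeries ℕ+ ℚ :=
  (l.parts.map elemSymm).prod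

/-- `f` is a (finite) linear combination of the `e_λ` with nonnegative coefficients. -/
def EPositive (f : MvPowerSeries ℕ+ ℚ) : Prop :=
  ∃ c : (Σ n : ℕ, n.Partition) →₀ ℚ,
    (∀ l, 0 ≤ c l) ∧ f = c.sum fun l a => a • elemSymmPart l.2

/-- A graph is `e`-positive if its chromatic symmetric function is. -/
def GraphEPositive {V : Type*} [Fintype V] (G : SimpleGraph V) : Prop :=
  EPositive (chromaticSymmetricFunction G)

/-- `G` is a disjoint union of cliques: every connected component is a clique. -/
def IsUnionOfCliques {V : Type*} (G : SimpleGraph V) : Prop :=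
  ∀ C : G.ConnectedComponent, G.IsClique C.supp

/-- `G` is the disjoint union of a complete multipartite graph `M` with `α(M) ≤ 2` and a graph `K₁`
(the vertex `v`). -/
def IsCompleteMultipartitePlusVertex {V : Type*} (G : SimpleGraph V) : Prop :=
  ∃ v : V, (∀ w, ¬ G.Adj v w) ∧
    (G.induce {v}ᶜ).IsCompleteMultipartite ∧ (G.induce {v}ᶜ).indepNum ≤ 2

/-! Structure: if some component contains non-adjacent `u`, `w`, then co-diamond-freeness leaves
room for just one further vertex `v`. Since `v` is isolated, an induced edge plus isolated vertex
elsewhere would complete to a co-diamond; hence non-adjacency is transitive off `v`. Claw-freeness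
bounds the parts by two.

Positivity: `chromaticSymmetricFunction` is multiplicative over disjoint unions
(`chromaticSymmetricFunction_eq_mul`) and `EPositive` is closed under products. In both cases every
factor is a graph whose complement is a matching (empty for a clique), so
`graphEPositive_of_compl_matching` suffices. For N vertices and K non-edges, X is the sum over i of
K(K-1)⋯(K-i+1) · `matchingCoeff (N - 2i) (K - i)` · e_{N-i} e_i. This is checked on a monomial with
t exponents 2 and the rest 1: `card_identifiesOnlyPairs` counts the colorings,
`coeff_elemSymm_mul_elemSymm` gives the coefficient of e_{N-i} e_i, and
`sum_descFactorial_mul_matchingCoeff_ite` equates the two sides. The coefficients are nonnegative by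
`permAvoiding_nonneg`. -/

/-! ### Structure of disconnected (claw, co-diamond)-free graphs. -/

theorem not_inducedFree_coDiamond {V : Type*} {G : SimpleGraph V} {a b x y : V}
    (hab : G.Adj a b) (hax : ¬ G.Adj a x) (hay : ¬ G.Adj a y) (hbx : ¬ G.Adj b x)
    (hby : ¬ G.Adj b y) (hxy : ¬ G.Adj x y) (hxy' : x ≠ y) (hax' : a ≠ x) (hay' : a ≠ y)
    (hbx' : b ≠ x) (hby' : b ≠ y) : ¬ InducedFree coDiamond G := by
  have hab' := hab.ne
  refine not_not.2 ⟨⟨⟨![x, y, a, b], ?_⟩, ?_⟩⟩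
  · intro i j h
    fin_cases i <;> fin_cases j <;> simp_all [eq_comm]
  · intro i j
    change G.Adj (![x, y, a, b] i) (![x, y, a, b] j) ↔ _
    rw [coDiamond_eq]
    fin_cases i <;> fin_cases j <;> simp_all [SimpleGraph.edge_adj, SimpleGraph.adj_comm]

theorem not_inducedFree_claw {V : Type*} {G : SimpleGraph V} {x a b c : V}
    (hxa : G.Adj x a) (hxb : G.Adj x b) (hxc : G.Adj x c) (hab : ¬ G.Adj a b)
    (hac : ¬ G.Adj a c) (hbc : ¬ G.Adj b c) (hab' : a ≠ b) (hac' : a ≠ c) (hbc' : b ≠ c) :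
    ¬ InducedFree claw G := by
  have ha := hxa.ne
  have hb := hxb.ne
  have hc := hxc.ne
  refine not_not.2 ⟨⟨⟨Sum.elim ![x] ![a, b, c], ?_⟩, ?_⟩⟩
  · rintro (i | i) (j | j) h <;> fin_cases i <;> fin_cases j <;> simp_all [eq_comm]
  · intro i j
    change G.Adj (Sum.elim ![x] ![a, b, c] i) (Sum.elim ![x] ![a, b, c] j) ↔ _
    rcases i with i | i <;> rcases j with j | j <;> fin_cases i <;> fin_cases j <;>
      simp_all [SimpleGraph.adj_comm]

theorem isUnionOfCliques_or_isCompleteMultipartitePlusVertex {V : Type*} [Finite V]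
    {G : SimpleGraph V} (hdisc : ¬ G.Connected) (hclaw : InducedFree claw G)
    (hcod : InducedFree coDiamond G) :
    IsUnionOfCliques G ∨ IsCompleteMultipartitePlusVertex G := by
  by_cases hU : IsUnionOfCliques G
  · exact Or.inl hU
  right
  simp only [IsUnionOfCliques, not_forall, SimpleGraph.isClique_iff, Set.Pairwise] at hU
  obtain ⟨C, u, hu, w, hw, huw, hnadj⟩ := hU
  have hmem : ∀ {x y}, x ∉ C.supp → y ∈ C.supp → ¬ G.Adj y x ∧ y ≠ x := by
    refine fun {x y} hx hy => ⟨fun h => hx ?_, fun h => hx (h ▸ hy)⟩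
    exact (C.mem_supp_congr_adj h).1 hy
  obtain ⟨b, hub⟩ : ∃ b, G.Adj u b := by
    obtain ⟨p⟩ := SimpleGraph.ConnectedComponent.exact (hu.trans hw.symm)
    cases p with
    | nil => exact absurd rfl huw
    | cons h _ => exact ⟨_, h⟩
  have hb : b ∈ C.supp := (C.mem_supp_congr_adj hub).1 hu
  obtain ⟨v, hv⟩ : ∃ v, v ∉ C.supp := by
    by_contra! h
    refine hdisc ((SimpleGraph.connected_iff _).2 ⟨fun x y => ?_, ⟨u⟩⟩)
    exact SimpleGraph.ConnectedComponent.exact ((h x).trans (h y).symm)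
  have huniq : ∀ x, x ∉ C.supp → x = v := by
    intro x hx
    by_contra hne
    -- Two vertices outside `C` give a co-diamond either way: the edge `x v` with `u`, `w`, or the
    -- edge `u b` with `x`, `v`.
    by_cases hxv : G.Adj x v
    · exact not_inducedFree_coDiamond hxv (fun h => (hmem hx hu).1 h.symm)
        (fun h => (hmem hx hw).1 h.symm) (fun h => (hmem hv hu).1 h.symm)
        (fun h => (hmem hv hw).1 h.symm) hnadj huw (hmem hx hu).2.symm (hmem hx hw).2.symm
        (hmem hv hu).2.symm (hmem hv hw).2.symm hcod
    · exact not_inducedFree_coDiamond hub (hmem hx hu).1 (hmem hv hu).1 (hmem hx hb).1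
        (hmem hv hb).1 hxv hne (hmem hx hu).2 (hmem hv hu).2 (hmem hx hb).2 (hmem hv hb).2 hcod
  have hiso : ∀ w, ¬ G.Adj v w := by
    intro w h
    have : w ∉ C.supp := fun hw => hv ((C.mem_supp_congr_adj h).2 hw)
    exact h.ne (huniq w this).symm
  -- A failure is an edge `x z` missing `y`; together with the isolated `v` it is a co-diamond.
  have htrans : ∀ {x y z}, x ≠ v → y ≠ v → z ≠ v → ¬ G.Adj x y → ¬ G.Adj y z → ¬ G.Adj x z := by
    intro x y z hx hy hz hxy hyz hxz
    by_cases h1 : x = y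
    · exact hyz (h1 ▸ hxz)
    by_cases h2 : z = y
    · exact hxy (h2 ▸ hxz)
    exact not_inducedFree_coDiamond hxz hxy (fun h => hiso _ h.symm) (fun h => hyz h.symm)
      (fun h => hiso _ h.symm) (fun h => hiso _ h.symm) hy h1 hx h2 hz hcod
  refine ⟨v, hiso, ?_, ?_⟩
  · refine ⟨fun x y z hxy hyz => ?_⟩
    exact htrans x.2 y.2 z.2 hxy hyz
  · by_contra! hlt
    classical
    have := Fintype.ofFinite V
    obtain ⟨s, hs⟩ := (G.induce {v}ᶜ).exists_isNIndepSet_indepNum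
    have hcard : 2 < s.card := by rw [hs.card_eq]; exact hlt
    obtain ⟨x, y, z, hx, hy, hz, hxy, hxz, hyz⟩ := Finset.two_lt_card_iff.1 hcard
    have h1 : ¬ G.Adj x y := hs.isIndepSet hx hy hxy
    have h2 : ¬ G.Adj x z := hs.isIndepSet hx hz hxz
    have h3 : ¬ G.Adj y z := hs.isIndepSet hy hz hyz
    have huv : u ≠ v := fun h => hv (h ▸ hu)
    have hbv : b ≠ v := fun h => hv (h ▸ hb)
    -- If `x` had no neighbor, transitivity through `x` would destroy the edge `u b`. The neighbor
    -- `a` lies in another part, so it also sees `y` and `z` and is the center of a claw.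
    obtain ⟨a, hav, hax⟩ : ∃ a, a ≠ v ∧ G.Adj a x := by
      by_contra! h
      exact htrans huv x.2 hbv (h u huv) (fun h' => h b hbv h'.symm) hub
    have hay : G.Adj a y := by
      by_contra h
      exact htrans hav y.2 x.2 h (fun h => h1 h.symm) hax
    have haz : G.Adj a z := by
      by_contra h
      exact htrans hav z.2 x.2 h (fun h => h2 h.symm) hax
    exact not_inducedFree_claw hax hay haz h1 h2 h3 (fun h => hxy (Subtype.ext h))
      (fun h => hxz (Subtype.ext h)) (fun h => hyz (Subtype.ext h)) hclaw

/-! ### Closure properties of e-positivity. -/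

theorem EPositive.elemSymmPart {n : ℕ} (l : n.Partition) : EPositive (elemSymmPart l) := by
  refine ⟨Finsupp.single ⟨n, l⟩ 1, fun m => ?_, ?_⟩
  · classical
    rw [Finsupp.single_apply]
    split_ifs <;> simp
  · rw [Finsupp.sum_single_index] <;> simp

theorem EPositive.zero : EPositive 0 := ⟨0, fun _ => le_rfl, by simp⟩

theorem EPositive.add {f g : MvPowerSeries ℕ+ ℚ} (hf : EPositive f) (hg : EPositive g) :
    EPositive (f + g) := by
  classical
  obtain ⟨c, hc, rfl⟩ := hf
  obtain ⟨c', hc', rfl⟩ := hg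
  refine ⟨c + c', fun l => add_nonneg (hc l) (hc' l), ?_⟩
  rw [Finsupp.sum_add_index'] <;> simp [add_smul]

theorem EPositive.smul {f : MvPowerSeries ℕ+ ℚ} (hf : EPositive f) {a : ℚ} (ha : 0 ≤ a) :
    EPositive (a • f) := by
  obtain ⟨c, hc, rfl⟩ := hf
  refine ⟨a • c, fun l => mul_nonneg ha (hc l), ?_⟩
  rw [Finsupp.sum_smul_index' (by simp), Finsupp.smul_sum]
  simp [mul_smul]

theorem EPositive.sum {ι : Type*} {s : Finset ι} {f : ι → MvPowerSeries ℕ+ ℚ}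
    (hf : ∀ i ∈ s, EPositive (f i)) : EPositive (∑ i ∈ s, f i) := by
  classical
  induction s using Finset.induction_on with
  | empty => simpa using EPositive.zero
  | insert a s ha ih =>
    rw [Finset.sum_insert ha]
    exact (hf a (by simp)).add (ih fun i hi => hf i (by simp [hi]))

theorem EPositive.multiset_prod (s : Multiset ℕ) (hs : ∀ i ∈ s, 0 < i) :
    EPositive (s.map elemSymm).prod :=
  EPositive.elemSymmPart (⟨s, fun {i} hi => hs i hi, rfl⟩ : s.sum.Partition)

/-- By bilinearity it is enough to multiply two basis products, and concatenating the parts of two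
partitions gives a partition. -/
theorem EPositive.mul {f g : MvPowerSeries ℕ+ ℚ} (hf : EPositive f) (hg : EPositive g) :
    EPositive (f * g) := by
  obtain ⟨c, hc, rfl⟩ := hf
  obtain ⟨c', hc', rfl⟩ := hg
  rw [Finsupp.sum, Finsupp.sum, Finset.sum_mul_sum]
  refine EPositive.sum fun l _ => EPositive.sum fun m _ => ?_
  rw [smul_mul_smul_comm]
  refine EPositive.smul ?_ (mul_nonneg (hc l) (hc' m))
  rw [_root_.elemSymmPart, _root_.elemSymmPart, ← Multiset.prod_add, ← Multiset.map_add]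
  refine EPositive.multiset_prod _ fun i hi => ?_
  rcases Multiset.mem_add.1 hi with h | h
  exacts [l.2.parts_pos h, m.2.parts_pos h]

theorem elemSymm_zero : elemSymm 0 = 1 := by
  classical
  ext d
  rw [MvPowerSeries.coeff_one]
  change (if _ then _ else _) = _
  congr 1
  simp only [Finsupp.degree_eq_zero_iff, eq_iff_iff, and_iff_left_iff_imp]
  rintro rfl
  simp

theorem EPositive.elemSymm (k : ℕ) : EPositive (elemSymm k) := by
  -- Zero is not a legal part, so `elemSymm 0 = 1` has to come from the empty partition.
  rcases Nat.eq_zero_or_pos k with rfl | hk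
  · simpa [elemSymm_zero] using EPositive.multiset_prod 0 (by simp)
  · simpa using EPositive.multiset_prod {k} (by simpa using hk)

/-! ### Multiplicativity over disjoint unions. -/

theorem colorContent_apply {V : Type*} [Fintype V] (κ : V → ℕ+) (c : ℕ+) :
    colorContent κ c = (Finset.univ.filter fun v => κ v = c).card := by
  classical
  rw [Finset.card_filter]
  simp only [colorContent, Finsupp.finsetSum_apply, Finsupp.single_apply]

theorem degree_colorContent {V : Type*} [Fintype V] (κ : V → ℕ+) :
    (colorContent κ).degree = Fintype.card V := by
  simp [colorContent, map_sum]

theorem colorContent_eq_add {V : Type*} [Fintype V] (κ : V → ℕ+) (P : V → Prop)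
    [DecidablePred P] :
    colorContent κ = colorContent (fun v : {v // P v} => κ v) +
      colorContent (fun v : {v // ¬ P v} => κ v) :=
  (Fintype.sum_subtype_add_sum_subtype P fun v => Finsupp.single (κ v) 1).symm

/-- With no edges across, proper colorings of the two sides glue freely and their contents add. So
colorings of content `d` correspond to a splitting of `d` with a coloring of each side. -/
theorem chromaticSymmetricFunction_eq_mul {V : Type*} [Fintype V] (G : SimpleGraph V)
    (P : V → Prop) [DecidablePred P] (hP : ∀ x y, P x → ¬ P y → ¬ G.Adj x y) :
    chromaticSymmetricFunction G =
      chromaticSymmetricFunction (G.comap (Subtype.val : {v // P v} → V)) *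
        chromaticSymmetricFunction (G.comap (Subtype.val : {v // ¬ P v} → V)) := by
  classical
  ext d
  rw [MvPowerSeries.coeff_mul]
  change (Nat.card _ : ℚ) = ∑ p ∈ _, (Nat.card _ : ℚ) * (Nat.card _ : ℚ)
  simp only [← Nat.cast_mul, ← Nat.card_prod]
  rw [← Nat.cast_sum, ← Finset.sum_coe_sort]
  have := fun (G : SimpleGraph {v // P v}) d => finite_colorContent_eq G d
  have := fun (G : SimpleGraph {v // ¬ P v}) d => finite_colorContent_eq G d
  rw [← Nat.card_sigma]
  congr 1
  let glue (κ₁ : (G.comap (Subtype.val : {v // P v} → V)).Coloring ℕ+)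
      (κ₂ : (G.comap (Subtype.val : {v // ¬ P v} → V)).Coloring ℕ+) : G.Coloring ℕ+ :=
    SimpleGraph.Coloring.mk (fun v => if h : P v then κ₁ ⟨v, h⟩ else κ₂ ⟨v, h⟩) (by
      intro x y hxy
      by_cases hx : P x <;> by_cases hy : P y
      · simpa [hx, hy] using κ₁.valid (v := ⟨x, hx⟩) (w := ⟨y, hy⟩) hxy
      · exact absurd hxy (hP x y hx hy)
      · exact absurd hxy.symm (hP y x hy hx)
      · simpa [hx, hy] using κ₂.valid (v := ⟨x, hx⟩) (w := ⟨y, hy⟩) hxy)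
  have glue₁ : ∀ κ₁ κ₂ (v : {v // P v}), glue κ₁ κ₂ v = κ₁ v := fun κ₁ κ₂ v =>
    dif_pos v.2
  have glue₂ : ∀ κ₁ κ₂ (v : {v // ¬ P v}), glue κ₁ κ₂ v = κ₂ v := fun κ₁ κ₂ v =>
    dif_neg v.2
  have content : ∀ κ₁ κ₂, colorContent (glue κ₁ κ₂) = colorContent κ₁ + colorContent κ₂ := by
    intro κ₁ κ₂
    rw [colorContent_eq_add _ P]
    simp only [glue₁, glue₂]
  refine (Nat.card_congr (Equiv.ofBijective (fun q => ⟨glue q.2.1.1 q.2.2.1, by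
    rw [content, q.2.1.2, q.2.2.2]
    exact Finset.HasAntidiagonal.mem_antidiagonal.1 q.1.2⟩) ⟨?_, ?_⟩)).symm
  · rintro ⟨⟨⟨d₁, d₂⟩, hd⟩, ⟨κ₁, k₁⟩, ⟨κ₂, k₂⟩⟩ ⟨⟨⟨d₃, d₄⟩, hd'⟩, ⟨κ₃, k₃⟩, ⟨κ₄, k₄⟩⟩ h
    dsimp only at k₁ k₂ k₃ k₄
    subst k₁ k₂ k₃ k₄
    have h' := fun v => DFunLike.congr_fun (congrArg Subtype.val h) v
    have e₁ : κ₁ = κ₃ := by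
      refine DFunLike.ext _ _ fun v => ?_
      simpa only [glue₁] using h' v
    have e₂ : κ₂ = κ₄ := by
      refine DFunLike.ext _ _ fun v => ?_
      simpa only [glue₂] using h' v
    subst e₁ e₂
    rfl
  · rintro ⟨κ, rfl⟩
    let κ₁ : (G.comap (Subtype.val : {v // P v} → V)).Coloring ℕ+ :=
      SimpleGraph.Coloring.mk (fun v => κ v) fun h => κ.valid h
    let κ₂ : (G.comap (Subtype.val : {v // ¬ P v} → V)).Coloring ℕ+ :=
      SimpleGraph.Coloring.mk (fun v => κ v) fun h => κ.valid h
    refine ⟨⟨⟨(colorContent κ₁, colorContent κ₂),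
      Finset.HasAntidiagonal.mem_antidiagonal.2 (colorContent_eq_add κ P).symm⟩, ⟨κ₁, rfl⟩, ⟨κ₂, rfl⟩⟩, ?_⟩
    refine Subtype.ext (DFunLike.ext _ _ fun v => ?_)
    by_cases h : P v
    · exact glue₁ κ₁ κ₂ ⟨v, h⟩
    · exact glue₂ κ₁ κ₂ ⟨v, h⟩

/-! ### Numerical identities for the coefficients. -/

/-- `∑ l, (-1) ^ l * K.choose l * (m - l)!`: for `K ≤ m`, the number of permutations of `m` letters
without fixed points among the first `K` letters. -/
def permAvoiding : ℕ → ℕ → ℚ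
  | m, 0 => m.factorial
  | m, K + 1 => permAvoiding m K - permAvoiding (m - 1) K

/-- Trades the subtraction in the definition for a recurrence whose factors are nonnegative when `K
≤ m`; this is the source of positivity. The truncated `K - 1` is harmless, being multiplied by `K`.
-/
theorem permAvoiding_succ_left {m K : ℕ} (h : K ≤ m) :
    permAvoiding (m + 1) K =
      ((m : ℚ) + 1 - K) * permAvoiding m K + K * permAvoiding m (K - 1) := by
  induction K generalizing m with
  | zero => simp [permAvoiding, Nat.factorial_succ]
  | succ K ih =>
    obtain ⟨m, rfl⟩ : ∃ m', m = m' + 1 := ⟨m - 1, by lia⟩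
    have h1 := ih (m := m + 1) (by lia)
    have h2 := ih (m := m) (by lia)
    rw [permAvoiding, Nat.add_sub_cancel, Nat.add_sub_cancel, h1]
    rcases K with _ | K
    · simp only [permAvoiding] at *
      push_cast [Nat.factorial_succ] at *
      ring_nf
    · have e1 : permAvoiding (m + 1) (K + 1 + 1) =
        permAvoiding (m + 1) (K + 1) - permAvoiding m (K + 1) := by
        rw [permAvoiding, Nat.add_sub_cancel]
      have e2 : permAvoiding (m + 1) (K + 1) =
        permAvoiding (m + 1) K - permAvoiding m K := by
        rw [permAvoiding, Nat.add_sub_cancel]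
      rw [e1]
      simp only [Nat.add_sub_cancel] at *
      push_cast at *
      linear_combination (-1) * h2 - ((K : ℚ) + 1) * e2

theorem permAvoiding_nonneg {m K : ℕ} (h : K ≤ m) : 0 ≤ permAvoiding m K := by
  induction K using Nat.strong_induction_on generalizing m with
  | _ K ih =>
    rcases K with _ | K
    · simp [permAvoiding]
    · obtain ⟨m, rfl⟩ : ∃ m', m = m' + 1 := ⟨m - 1, by lia⟩
      have h1 : permAvoiding (m + 1) (K + 1) =
          ((m : ℚ) - K) * permAvoiding m K + K * permAvoiding m (K - 1) := by
        rw [permAvoiding, Nat.add_sub_cancel, permAvoiding_succ_left (by lia)]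
        ring
      rw [h1]
      have h2 : (K : ℚ) ≤ m := by exact_mod_cast (by lia : K ≤ m)
      have h3 := ih K (by lia) (show K ≤ m by lia)
      have h4 := ih (K - 1) (by lia) (show K - 1 ≤ m by lia)
      have := mul_nonneg (sub_nonneg.2 h2) h3
      positivity

theorem permAvoiding_eq_sum (m K : ℕ) :
    permAvoiding m K =
      ∑ l ∈ Finset.range (K + 1), (-1) ^ l * (K.choose l : ℚ) * (m - l).factorial := by
  induction K generalizing m with
  | zero => simp [permAvoiding]
  | succ K ih =>
    rw [permAvoiding, ih, ih, Finset.sum_range_succ' _ (K + 1), Finset.sum_range_succ' _ K]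
    have h : ∀ l ∈ Finset.range (K + 1),
        (-1) ^ (l + 1) * ((K + 1).choose (l + 1) : ℚ) * (m - (l + 1)).factorial =
          (-1) ^ (l + 1) * (K.choose (l + 1) : ℚ) * (m - (l + 1)).factorial -
            (-1) ^ l * (K.choose l : ℚ) * (m - 1 - l).factorial := by
      intro l _
      rw [Nat.choose_succ_succ, Nat.sub_sub, add_comm 1 l]
      push_cast
      ring
    rw [Finset.sum_congr rfl h, Finset.sum_sub_distrib,
      Finset.sum_range_succ
        (fun l => (-1) ^ (l + 1) * (K.choose (l + 1) : ℚ) * (m - (l + 1)).factorial) K,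
      Nat.choose_succ_self, Nat.choose_zero_right, Nat.choose_zero_right]
    push_cast
    ring

/-- The coefficients of the `e`-expansion for complements of matchings, up to a falling
factorial. -/
def matchingCoeff (N K : ℕ) : ℚ := if N = 0 then 1 else N * permAvoiding (N - 1) K

theorem matchingCoeff_nonneg {N K : ℕ} (h : 2 * K ≤ N) : 0 ≤ matchingCoeff N K := by
  rw [matchingCoeff]
  split_ifs with h0
  · exact zero_le_one
  · exact mul_nonneg (Nat.cast_nonneg _) (permAvoiding_nonneg (by lia))

/-- The partial sums of this hypergeometric sum have a closed form, so induction on `r` needs only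
Pascal's rule and the ratio of consecutive binomials. -/
theorem sum_range_telescope {s N r : ℕ} (hr : r < s) (hs : 2 * s ≤ N) :
    ∑ i ∈ Finset.range (r + 1), (-1) ^ i * (s.choose i : ℚ) * ((N : ℚ) - 2 * i) *
      (N - i - s - 1).factorial / (N - i).factorial =
    (-1) ^ r * ((s - 1).choose r : ℚ) * (N - r - s - 1).factorial / (N - r - 1).factorial := by
  obtain ⟨s, rfl⟩ : ∃ s', s = s' + 1 := ⟨s - 1, by lia⟩
  induction r with
  | zero =>
    obtain ⟨N, rfl⟩ : ∃ N', N = N' + 1 := ⟨N - 1, by lia⟩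
    have := Nat.factorial_ne_zero N
    simp [Nat.factorial_succ]
    field_simp
  | succ r ih =>
    rw [Finset.sum_range_succ, ih (by lia)]
    -- This substitution removes all truncated subtractions; it is available because `r + 1 < s + 1`
    -- and `2 * (s + 1) ≤ N`.
    obtain ⟨M, rfl⟩ : ∃ M, N = M + r + s + 3 := ⟨N - (r + s + 3), by lia⟩
    rw [show M + r + s + 3 - r - (s + 1) - 1 = M + 1 by lia,
      show M + r + s + 3 - r - 1 = M + s + 1 + 1 by lia,
      show M + r + s + 3 - (r + 1) - (s + 1) - 1 = M by lia,
      show M + r + s + 3 - (r + 1) = M + s + 1 + 1 by lia,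
      show M + s + 1 + 1 - 1 = M + s + 1 by lia, Nat.add_sub_cancel]
    have hc : ((s + 1).choose (r + 1) : ℚ) = s.choose r + s.choose (r + 1) := by
      exact_mod_cast Nat.choose_succ_succ s r
    have hc2 : (s.choose (r + 1) : ℚ) * (r + 1) = s.choose r * (s - r) := by
      have := Nat.choose_succ_right_eq s r
      rw [← Nat.cast_sub (by lia)]
      exact_mod_cast this
    have h1 := Nat.factorial_ne_zero (M + s + 1)
    rw [hc, Nat.factorial_succ M, Nat.factorial_succ (M + s + 1)]
    push_cast
    have : ((M + s + 1).factorial : ℚ) ≠ 0 := by exact_mod_cast h1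
    have h2 : (M : ℚ) + s + 1 + 1 ≠ 0 := by positivity
    rw [← add_div, div_eq_div_iff (by positivity) (by positivity), pow_succ]
    linear_combination ((-1) ^ r * (M.factorial : ℚ) * (M + s + 1).factorial) * hc2

theorem sum_range_alternating {s N : ℕ} (hs : 2 * s ≤ N) :
    ∑ i ∈ Finset.range (s + 1), (N.choose i : ℚ) * ((-1) ^ (s - i) / (s - i).factorial *
      (if N - 2 * i = 0 then 1 else ((N - 2 * i : ℕ) : ℚ) * (N - 2 * i - 1 - (s - i)).factorial)) =
    if s = 0 then (N.factorial : ℚ) else 0 := by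
  -- The convention at 0 makes the last term a plain factorial, extending N · (N - 1)! = N! to N =
  -- 0. Only this term can meet the exceptional case.
  have hterm : (if N - 2 * s = 0 then 1
      else ((N - 2 * s : ℕ) : ℚ) * (N - 2 * s - 1 - (s - s)).factorial) =
      ((N - 2 * s).factorial : ℚ) := by
    rcases N - 2 * s with _ | M
    · simp
    · simp [Nat.factorial_succ]
  rw [Finset.sum_range_succ, hterm]
  rcases s with _ | s
  · simp
  rw [if_neg (by lia)]
  -- This covers every index but the last; after rescaling, the closed form is the negative of the
  -- last term.
  have hsum := sum_range_telescope (s := s + 1) (N := N) (r := s) (by lia) hs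
  have hcongr : ∀ i ∈ Finset.range (s + 1), (N.choose i : ℚ) * ((-1) ^ (s + 1 - i) /
      (s + 1 - i).factorial * (if N - 2 * i = 0 then 1 else ((N - 2 * i : ℕ) : ℚ) *
        (N - 2 * i - 1 - (s + 1 - i)).factorial)) =
      (N.factorial : ℚ) / (s + 1).factorial * (-1) ^ (s + 1) *
        ((-1) ^ i * ((s + 1).choose i : ℚ) * ((N : ℚ) - 2 * i) *
          (N - i - (s + 1) - 1).factorial / (N - i).factorial) := by
    intro i hi
    have hi' := Finset.mem_range.1 hi
    rw [if_neg (by lia), show N - 2 * i - 1 - (s + 1 - i) = N - i - (s + 1) - 1 by lia,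
      Nat.cast_choose ℚ (by lia : i ≤ N), Nat.cast_choose ℚ (by lia : i ≤ s + 1),
      Nat.cast_sub (by lia)]
    have hsign : ((-1) ^ (s + 1 - i) : ℚ) = (-1) ^ (s + 1) * (-1) ^ i := by
      rw [← pow_add, show s + 1 + i = s + 1 - i + 2 * i by lia, pow_add, pow_mul]
      simp
    have h1 : (i.factorial : ℚ) ≠ 0 := by exact_mod_cast Nat.factorial_ne_zero _
    have h2 : ((N - i).factorial : ℚ) ≠ 0 := by exact_mod_cast Nat.factorial_ne_zero _
    have h3 : ((s + 1 - i).factorial : ℚ) ≠ 0 := by exact_mod_cast Nat.factorial_ne_zero _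
    have h4 : ((s + 1).factorial : ℚ) ≠ 0 := by exact_mod_cast Nat.factorial_ne_zero _
    rw [hsign]
    field_simp
    push_cast
    ring
  rw [Finset.sum_congr rfl hcongr, ← Finset.mul_sum, hsum, Nat.cast_choose ℚ (by lia : s + 1 ≤ N),
    show N - s - (s + 1) - 1 = N - 2 * (s + 1) by lia, show N - s - 1 = N - (s + 1) by lia]
  have h2 : ((N - (s + 1)).factorial : ℚ) ≠ 0 := by exact_mod_cast Nat.factorial_ne_zero _
  have h4 : ((s + 1).factorial : ℚ) ≠ 0 := by exact_mod_cast Nat.factorial_ne_zero _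
  have hsq : ((-1) ^ s * (-1) ^ s : ℚ) = 1 := by rw [← mul_pow]; simp
  simp
  field_simp
  rw [pow_succ]
  linear_combination (-(N.factorial : ℚ) * (N - 2 * (s + 1)).factorial) * hsq

/-- This is the coefficient comparison at squarefree monomials. Expanding `permAvoiding` by
inclusion-exclusion turns it into a double sum whose diagonals vanish except the zeroth. -/
theorem sum_descFactorial_mul_matchingCoeff {N K : ℕ} (h : 2 * K ≤ N) :
    ∑ i ∈ Finset.range (K + 1),
      (K.descFactorial i : ℚ) * matchingCoeff (N - 2 * i) (K - i) * N.choose i = N.factorial := by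
  let F : ℕ → ℕ → ℚ := fun i l => (K.descFactorial (i + l) : ℚ) *
    ((N.choose i : ℚ) * ((-1) ^ l / l.factorial * (if N - 2 * i = 0 then 1 else
      ((N - 2 * i : ℕ) : ℚ) * (N - 2 * i - 1 - l).factorial)))
  have h1 : ∀ i ∈ Finset.range (K + 1),
      (K.descFactorial i : ℚ) * matchingCoeff (N - 2 * i) (K - i) * N.choose i =
        ∑ l ∈ Finset.range (K + 1 - i), F i l := by
    intro i hi
    have hi' := Finset.mem_range.1 hi
    have hM : matchingCoeff (N - 2 * i) (K - i) = ∑ l ∈ Finset.range (K - i + 1),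
        (-1) ^ l * ((K - i).choose l : ℚ) * (if N - 2 * i = 0 then 1 else
          ((N - 2 * i : ℕ) : ℚ) * (N - 2 * i - 1 - l).factorial) := by
      rw [matchingCoeff]
      split_ifs with h0
      · have : K - i = 0 := by lia
        simp [this]
      · rw [permAvoiding_eq_sum, Finset.mul_sum]
        exact Finset.sum_congr rfl fun l _ => by ring
    rw [hM, Finset.mul_sum, Finset.sum_mul, show K + 1 - i = K - i + 1 by lia]
    refine Finset.sum_congr rfl fun l _ => ?_
    have hd : (K.descFactorial (i + l) : ℚ) =
        K.descFactorial i * ((K - i).choose l * l.factorial) := by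
      rw [← Nat.cast_mul, ← Nat.cast_mul, mul_comm ((K - i).choose l),
        ← Nat.descFactorial_eq_factorial_mul_choose, ← Nat.descFactorial_mul_descFactorial
          (by lia : i ≤ i + l), Nat.add_sub_cancel_left, mul_comm]
    have hl : (l.factorial : ℚ) ≠ 0 := by exact_mod_cast Nat.factorial_ne_zero _
    simp only [F, hd]
    field_simp
  -- On the diagonal `s = i + l` the falling factorial is constant, leaving the inner sum of
  -- `sum_range_alternating`.
  rw [Finset.sum_congr rfl h1, ← Finset.sum_range_diag_flip]
  have h2 : ∀ s ∈ Finset.range (K + 1), ∑ i ∈ Finset.range (s + 1), F i (s - i) =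
      (K.descFactorial s : ℚ) * if s = 0 then (N.factorial : ℚ) else 0 := by
    intro s hs
    have hs' := Finset.mem_range.1 hs
    rw [← sum_range_alternating (s := s) (N := N) (by lia), Finset.mul_sum]
    refine Finset.sum_congr rfl fun i hi => ?_
    have := Finset.mem_range.1 hi
    simp only [F, show i + (s - i) = s by lia]
  rw [Finset.sum_congr rfl h2]
  simp

/-- The shift `i ↦ t + i` reduces this to the case of `N - 2t` and `K - t` with no doubled exponent,
after factoring out `K.descFactorial t`. -/
theorem sum_descFactorial_mul_matchingCoeff_ite {N K t : ℕ} (h : 2 * K ≤ N) :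
    ∑ i ∈ Finset.range (K + 1), (K.descFactorial i : ℚ) * matchingCoeff (N - 2 * i) (K - i) *
      (if t ≤ i then ((N - 2 * t).choose (i - t) : ℚ) else 0) =
    K.descFactorial t * (N - 2 * t).factorial := by
  rcases lt_or_ge K t with hKt | hKt
  · rw [Nat.descFactorial_of_lt hKt, Nat.cast_zero, zero_mul]
    refine Finset.sum_eq_zero fun i hi => ?_
    have := Finset.mem_range.1 hi
    rw [if_neg (by lia), mul_zero]
  · rw [← sum_descFactorial_mul_matchingCoeff (N := N - 2 * t) (K := K - t) (by lia),
      show K + 1 = t + (K - t + 1) by lia, Finset.sum_range_add, Finset.mul_sum]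
    rw [Finset.sum_eq_zero, zero_add]
    · refine Finset.sum_congr rfl fun i _ => ?_
      rw [if_pos (by lia), ← Nat.descFactorial_mul_descFactorial (by lia : t ≤ t + i),
        Nat.add_sub_cancel_left, show N - 2 * (t + i) = N - 2 * t - 2 * i by lia,
        show K - (t + i) = K - t - i by lia]
      push_cast
      ring
    · intro i hi
      have := Finset.mem_range.1 hi
      rw [if_neg (by lia), mul_zero]

/-! ### Coefficients of a product of two elementary symmetric functions. -/

theorem coeff_elemSymm_mul_elemSymm_eq_zero {a b : ℕ} {d : ℕ+ →₀ ℕ}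
    (h : d.degree ≠ a + b ∨ ∃ c, 2 < d c) :
    MvPowerSeries.coeff d (elemSymm a * elemSymm b) = 0 := by
  classical
  rw [MvPowerSeries.coeff_mul]
  refine Finset.sum_eq_zero fun p hp => ?_
  rw [Finset.HasAntidiagonal.mem_antidiagonal] at hp
  change (if _ then (1 : ℚ) else 0) * (if _ then (1 : ℚ) else 0) = 0
  rw [ite_zero_mul_ite_zero, if_neg]
  rintro ⟨⟨h1, h2⟩, h3, h4⟩
  subst hp
  rcases h with h | ⟨c, h⟩
  · exact h (by rw [map_add, h1, h3])
  · have := h2 c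
    have := h4 c
    rw [Finsupp.add_apply] at h
    lia

theorem degree_eq_card_add_two_mul_card {d : ℕ+ →₀ ℕ} (h2 : ∀ c, d c ≤ 2) :
    d.degree = (d.support.filter fun c => d c = 1).card +
      2 * (d.support.filter fun c => d c = 2).card := by
  rw [Finsupp.degree_apply, Finset.card_filter, Finset.card_filter, Finset.mul_sum,
    ← Finset.sum_add_distrib]
  refine Finset.sum_congr rfl fun c hc => ?_
  have := h2 c
  have := Finsupp.mem_support_iff.1 hc
  split_ifs <;> lia

/-- A variable of exponent 2 must occur in both squarefree factors; the only freedom is which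
variables of exponent 1 fill up the second one. -/
theorem coeff_elemSymm_mul_elemSymm {a b : ℕ} {d : ℕ+ →₀ ℕ} (hd : d.degree = a + b)
    (h2 : ∀ c, d c ≤ 2) :
    MvPowerSeries.coeff d (elemSymm a * elemSymm b) =
      if (d.support.filter fun c => d c = 2).card ≤ b then
        ((a + b - 2 * (d.support.filter fun c => d c = 2).card).choose
          (b - (d.support.filter fun c => d c = 2).card) : ℚ) else 0 := by
  classical
  set twos := d.support.filter fun c => d c = 2 with htwos
  set ones := d.support.filter fun c => d c = 1 with hones
  have hdeg := degree_eq_card_add_two_mul_card h2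
  rw [← htwos, ← hones] at hdeg
  have memt : ∀ c, c ∈ twos ↔ d c = 2 := by intro c; simp [htwos]; lia
  have memo : ∀ c, c ∈ ones ↔ d c = 1 := by intro c; simp [hones]; lia
  have hdisj : ∀ T ⊆ ones, Disjoint twos T := by
    intro T hT
    refine Finset.disjoint_left.2 fun c hc hc' => ?_
    have := (memt c).1 hc
    have := (memo c).1 (hT hc')
    lia
  let ind : Finset ℕ+ → (ℕ+ →₀ ℕ) := fun S => ∑ c ∈ S, Finsupp.single c 1
  have ind_apply : ∀ S c, ind S c = if c ∈ S then 1 else 0 := by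
    intro S c
    simp [ind, Finsupp.finsetSum_apply, Finsupp.single_apply]
  have ind_degree : ∀ S, (ind S).degree = S.card := by
    intro S
    simp [ind, map_sum]
  have ind_eq : ∀ f : ℕ+ →₀ ℕ, (∀ c, f c ≤ 1) → f = ind f.support := by
    intro f hf
    ext c
    rw [ind_apply]
    have := hf c
    split_ifs with h
    · have := Finsupp.mem_support_iff.1 h
      lia
    · exact Finsupp.notMem_support_iff.1 h
  rw [MvPowerSeries.coeff_mul]
  have hsum : ∀ p ∈ Finset.HasAntidiagonal.antidiagonal d,
      MvPowerSeries.coeff p.1 (elemSymm a) * MvPowerSeries.coeff p.2 (elemSymm b) =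
      if (∀ i, p.1 i ≤ 1) ∧ (∀ i, p.2 i ≤ 1) ∧ p.2.degree = b then (1 : ℚ) else 0 := by
    intro p hp
    rw [Finset.HasAntidiagonal.mem_antidiagonal] at hp
    change (if _ then (1 : ℚ) else 0) * (if _ then (1 : ℚ) else 0) = _
    rw [ite_zero_mul_ite_zero, mul_one]
    congr 1
    rw [← hp, map_add] at hd
    simp only [eq_iff_iff]
    constructor
    · rintro ⟨⟨h1, h2⟩, h3, h4⟩
      exact ⟨h2, h4, h3⟩
    · rintro ⟨h2, h4, h3⟩
      exact ⟨⟨by lia, h2⟩, h3, h4⟩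
  rw [Finset.sum_congr rfl hsum, Finset.sum_boole]
  -- `T` is the set of exponent-1 variables assigned to the second factor.
  have key : (Finset.filter (fun p : (ℕ+ →₀ ℕ) × (ℕ+ →₀ ℕ) => (∀ i, p.1 i ≤ 1) ∧
      (∀ i, p.2 i ≤ 1) ∧ p.2.degree = b) (Finset.HasAntidiagonal.antidiagonal d)).card =
      (ones.powerset.filter fun T => twos.card + T.card = b).card := by
    symm
    refine Finset.card_bij (fun T _ => (ind (ones \ T ∪ twos), ind (twos ∪ T))) ?_ ?_ ?_
    · intro T hT
      simp only [Finset.mem_filter, Finset.mem_powerset,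
        Finset.HasAntidiagonal.mem_antidiagonal] at hT ⊢
      refine ⟨?_, ?_, ?_, ?_⟩
      · ext c
        rw [Finsupp.add_apply, ind_apply, ind_apply]
        simp only [Finset.mem_union, Finset.mem_sdiff, memt, memo]
        have h1 := h2 c
        by_cases hc : c ∈ T
        · have := (memo c).1 (hT.1 hc)
          simp [hc, this]
        · have : d c = 0 ∨ d c = 1 ∨ d c = 2 := by lia
          rcases this with h | h | h <;> simp [hc, h]
      · intro c
        rw [ind_apply]
        split_ifs <;> lia
      · intro c
        rw [ind_apply]
        split_ifs <;> lia
      · rw [ind_degree, Finset.card_union_of_disjoint (hdisj T hT.1), hT.2]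
    · intro T hT T' hT' h
      simp only [Finset.mem_filter, Finset.mem_powerset] at hT hT'
      ext c
      have := DFunLike.congr_fun (congrArg Prod.snd h) c
      simp only [ind_apply] at this
      have h1 : c ∈ twos → c ∉ T := fun hc => Finset.disjoint_left.1 (hdisj T hT.1) hc
      have h2 : c ∈ twos → c ∉ T' := fun hc => Finset.disjoint_left.1 (hdisj T' hT'.1) hc
      by_cases hc : c ∈ twos
      · simp [h1 hc, h2 hc]
      · simp only [Finset.mem_union, hc, false_or] at this
        by_cases hx : c ∈ T <;> by_cases hy : c ∈ T' <;> simp [hx, hy] at this ⊢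
    · rintro ⟨d₁, d₂⟩ hp
      simp only [Finset.mem_filter, Finset.HasAntidiagonal.mem_antidiagonal] at hp
      obtain ⟨hp, h1, h2, h3⟩ := hp
      have happ : ∀ c, d₁ c + d₂ c = d c := fun c => by rw [← hp]; rfl
      have hs : twos ∪ (d₂.support \ twos) = d₂.support := by
        refine Finset.union_sdiff_of_subset fun c hc => ?_
        have := (memt c).1 hc
        have := happ c
        have := h1 c
        have := h2 c
        exact Finsupp.mem_support_iff.2 (by lia)
      have hsub : d₂.support \ twos ⊆ ones := by
        intro c hc
        rw [Finset.mem_sdiff, Finsupp.mem_support_iff, memt] at hc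
        have := happ c
        have := h1 c
        have := h2 c
        exact (memo c).2 (by lia)
      refine ⟨d₂.support \ twos, ?_, ?_⟩
      · rw [Finset.mem_filter, Finset.mem_powerset, ← Finset.card_union_of_disjoint
          (hdisj _ hsub), hs, ← ind_degree, ← ind_eq d₂ h2]
        exact ⟨hsub, h3⟩
      · rw [hs, ← ind_eq d₂ h2]
        congr 1
        ext c
        rw [ind_apply]
        simp only [Finset.mem_union, Finset.mem_sdiff, memt, memo, Finsupp.mem_support_iff]
        have := happ c
        have := h1 c
        have := h2 c
        split_ifs <;> lia
  rw [key]
  split_ifs with hb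
  · have : (ones.powerset.filter fun T => twos.card + T.card = b) =
        ones.powersetCard (b - twos.card) := by
      ext T
      rw [Finset.mem_filter, Finset.mem_powerset, Finset.mem_powersetCard]
      refine and_congr_right fun _ => ?_
      lia
    rw [this, Finset.card_powersetCard]
    congr 2
    lia
  · rw [Finset.filter_eq_empty_iff.2, Finset.card_empty, Nat.cast_zero]
    intro T _
    lia

/-! ### Counting colorings of the complement of a matching. -/

/-- A map identifies at most the two points `p (i, false)` and `p (i, true)`, for each `i`. -/
def IdentifiesOnlyPairs {ι V C : Type*} (p : ι × Bool → V) (κ : V → C) : Prop :=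
  ∀ x y, κ x = κ y → x ≠ y → ∃ i s, x = p (i, s) ∧ y = p (i, !s)

theorem finite_identifiesOnlyPairs {ι V : Type*} [Fintype V] (p : ι × Bool → V)
    (d : ℕ+ →₀ ℕ) (Q : (V → ℕ+) → Prop) :
    Finite {κ : V → ℕ+ // (IdentifiesOnlyPairs p κ ∧ colorContent κ = d) ∧ Q κ} := by
  have := finite_colorContent_eq (⊥ : SimpleGraph V) d
  refine Finite.of_injective (β := {κ : (⊥ : SimpleGraph V).Coloring ℕ+ // colorContent κ = d})
    (fun κ => ⟨SimpleGraph.Coloring.mk κ.1 fun h => h.elim, κ.2.1.2⟩) ?_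
  intro κ κ' h
  refine Subtype.ext (funext fun v => ?_)
  exact DFunLike.congr_fun (congrArg Subtype.val h) v

/-- With a squarefree content the pairs play no role: the colorings are the bijections from `V` to
the support. -/
theorem card_identifiesOnlyPairs_of_le_one {ι V : Type*} [Fintype V] (p : ι × Bool → V)
    {d : ℕ+ →₀ ℕ} (hd : d.degree = Fintype.card V) (h1 : ∀ c, d c ≤ 1) :
    Nat.card {κ : V → ℕ+ // IdentifiesOnlyPairs p κ ∧ colorContent κ = d} =
      (Fintype.card V).factorial := by
  classical
  have hsupp : ∀ c ∈ d.support, d c = 1 := by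
    intro c hc
    have := Finsupp.mem_support_iff.1 hc
    have := h1 c
    lia
  have hcard : Fintype.card V = Fintype.card d.support := by
    rw [← hd, Finsupp.degree_apply, Finset.sum_congr rfl hsupp, Fintype.card_coe]
    simp
  rw [← Fintype.card_equiv (Fintype.equivOfCardEq hcard), ← Nat.card_eq_fintype_card]
  have hval : ∀ e : V ≃ d.support, IdentifiesOnlyPairs p (fun v => (e v : ℕ+)) ∧
      colorContent (fun v => (e v : ℕ+)) = d := by
    intro e
    constructor
    · intro x y h hne
      exact absurd (e.injective (Subtype.ext h)) hne
    · rw [colorContent, Equiv.sum_comp e fun c : d.support => Finsupp.single (c : ℕ+) 1,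
        Finset.sum_coe_sort d.support fun c => Finsupp.single c 1]
      conv_rhs => rw [← Finsupp.sum_single d, Finsupp.sum]
      exact Finset.sum_congr rfl fun c hc => by rw [hsupp c hc]
  refine (Nat.card_congr (Equiv.ofBijective
    (fun e : V ≃ d.support => ⟨fun v => (e v : ℕ+), hval e⟩) ⟨?_, ?_⟩)).symm
  · intro e e' h
    refine Equiv.ext fun v => Subtype.ext ?_
    exact congrFun (congrArg Subtype.val h) v
  · rintro ⟨κ, -, rfl⟩
    have hmem : ∀ v, κ v ∈ (colorContent κ).support := by
      intro v
      rw [Finsupp.mem_support_iff, colorContent_apply]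
      exact (Finset.card_pos.2 ⟨v, by simp⟩).ne'
    have hinj : Function.Injective fun v => (⟨κ v, hmem v⟩ : (colorContent κ).support) := by
      intro x y hxy
      have := h1 (κ x)
      rw [colorContent_apply, Finset.card_le_one] at this
      exact this x (by simp) y (by simpa using (congrArg Subtype.val hxy).symm)
    exact ⟨Equiv.ofBijective _ ((Fintype.bijective_iff_injective_and_card _).2 ⟨hinj, hcard⟩),
      rfl⟩

section RemovePair

variable {ι V : Type*} (p : ι × Bool → V)

/-- The pairs other than the `i`-th one, as pairs of points outside the `i`-th pair. -/
def removePair (hp : Function.Injective p) (i : ι) (q : {j // j ≠ i} × Bool) :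
    {v // ∀ s, v ≠ p (i, s)} :=
  ⟨p (q.1, q.2), fun _ h => q.1.2 (congrArg Prod.fst (hp h))⟩

theorem removePair_injective (hp : Function.Injective p) (i : ι) :
    Function.Injective (removePair p hp i) := by
  rintro ⟨j, s⟩ ⟨j', s'⟩ h
  have := hp (congrArg Subtype.val h)
  rw [Prod.mk.injEq] at this
  exact Prod.ext (Subtype.ext this.1) this.2

/-- The two points of the `i`-th pair. -/
noncomputable def pairEquiv (hp : Function.Injective p) (i : ι) :
    Bool ≃ {v // ¬ ∀ s, v ≠ p (i, s)} :=
  Equiv.ofBijective (fun s => ⟨p (i, s), fun h => h s rfl⟩) ⟨fun s s' h =>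
    congrArg Prod.snd (hp (congrArg Subtype.val h)), fun v => by
      have := v.2
      push Not at this
      obtain ⟨s, hs⟩ := this
      exact ⟨s, Subtype.ext hs.symm⟩⟩

open Classical in
theorem card_removePair [Fintype V] (hp : Function.Injective p) (i : ι) :
    Fintype.card {v // ∀ s, v ≠ p (i, s)} + 2 = Fintype.card V := by
  have h := Fintype.card_congr (pairEquiv p hp i)
  rw [Fintype.card_subtype_compl, Fintype.card_bool] at h
  have := Fintype.card_subtype_le fun v => ∀ s, v ≠ p (i, s)
  lia

open Classical in
theorem colorContent_eq_add_single [Fintype V] (hp : Function.Injective p) {i : ι} {c : ℕ+}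
    {κ : V → ℕ+} (hκ : ∀ s, κ (p (i, s)) = c) :
    colorContent κ = colorContent (fun v : {v // ∀ s, v ≠ p (i, s)} => κ v) +
      Finsupp.single c 2 := by
  rw [colorContent_eq_add κ fun v => ∀ s, v ≠ p (i, s)]
  congr 1
  rw [colorContent, ← Equiv.sum_comp (pairEquiv p hp i), Fintype.sum_bool]
  change Finsupp.single (κ (p (i, true))) 1 + Finsupp.single (κ (p (i, false))) 1 = _
  rw [hκ, hκ, ← Finsupp.single_add]

open Classical in
theorem card_identifiesOnlyPairs_removePair [Fintype V] (hp : Function.Injective p) (i : ι)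
    {c : ℕ+} {d : ℕ+ →₀ ℕ} (hc : d c = 2) :
    Nat.card {κ : V → ℕ+ // (IdentifiesOnlyPairs p κ ∧ colorContent κ = d) ∧
      ∀ s, κ (p (i, s)) = c} =
    Nat.card {κ : {v // ∀ s, v ≠ p (i, s)} → ℕ+ //
      IdentifiesOnlyPairs (removePair p hp i) κ ∧ colorContent κ = d.erase c} := by
  have hd : d = d.erase c + Finsupp.single c 2 := by
    rw [← hc, Finsupp.erase_add_single]
  refine Nat.card_congr (Equiv.ofBijective (fun κ => ⟨fun v => κ.1 v, ?_, ?_⟩) ⟨?_, ?_⟩)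
  · intro x y hxy hne
    obtain ⟨j, s, h1, h2⟩ := κ.2.1.1 x y hxy (fun h => hne (Subtype.ext h))
    refine ⟨⟨j, ?_⟩, s, Subtype.ext h1, Subtype.ext h2⟩
    rintro rfl
    exact x.2 s h1
  · have := κ.2.1.2
    rw [colorContent_eq_add_single p hp κ.2.2] at this
    conv_rhs at this => rw [hd]
    exact add_right_cancel this
  · rintro ⟨κ, h1, h2⟩ ⟨κ', h1', h2'⟩ h
    refine Subtype.ext (funext fun v => ?_)
    by_cases hv : ∀ s, v ≠ p (i, s)
    · exact congrFun (congrArg Subtype.val h) ⟨v, hv⟩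
    · push Not at hv
      obtain ⟨s, rfl⟩ := hv
      exact (h2 s).trans (h2' s).symm
  · rintro ⟨κ, h1, h2⟩
    let κ' : V → ℕ+ := fun v => if h : ∀ s, v ≠ p (i, s) then κ ⟨v, h⟩ else c
    have hin : ∀ v (h : ∀ s, v ≠ p (i, s)), κ' v = κ ⟨v, h⟩ := fun v h => dif_pos h
    have hout : ∀ s, κ' (p (i, s)) = c := fun s => dif_neg fun h => h s rfl
    -- The remaining content omits `c`, so giving color `c` to the restored pair creates no new
    -- coincidence.
    have hne : ∀ v, κ v ≠ c := by
      intro v hv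
      have := DFunLike.congr_fun h2 c
      rw [Finsupp.erase_same, colorContent_apply, Finset.card_eq_zero] at this
      exact Finset.notMem_empty v (this ▸ by simpa using hv)
    have hres : (fun v : {v // ∀ s, v ≠ p (i, s)} => κ' v) = κ :=
      funext fun v => hin v v.2
    refine ⟨⟨κ', ⟨?_, ?_⟩, hout⟩, Subtype.ext hres⟩
    · intro x y hxy hxy'
      by_cases hx : ∀ s, x ≠ p (i, s) <;> by_cases hy : ∀ s, y ≠ p (i, s)
      · rw [hin x hx, hin y hy] at hxy
        obtain ⟨j, s, e1, e2⟩ := h1 _ _ hxy (fun h => hxy' (congrArg Subtype.val h))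
        exact ⟨j, s, congrArg Subtype.val e1, congrArg Subtype.val e2⟩
      · push Not at hy
        obtain ⟨s, rfl⟩ := hy
        rw [hin x hx, hout] at hxy
        exact absurd hxy (hne _)
      · push Not at hx
        obtain ⟨s, rfl⟩ := hx
        rw [hin y hy, hout] at hxy
        exact absurd hxy.symm (hne _)
      · push Not at hx hy
        obtain ⟨s, rfl⟩ := hx
        obtain ⟨s', rfl⟩ := hy
        refine ⟨i, s, rfl, ?_⟩
        have : s' ≠ s := fun h => hxy' (by rw [h])
        rw [Bool.eq_not.2 this]
    · rw [colorContent_eq_add_single p hp hout, hres, h2, ← hd]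

theorem card_identifiesOnlyPairs_eq_sum [Fintype ι] [Fintype V] (hp : Function.Injective p)
    {c : ℕ+} {d : ℕ+ →₀ ℕ} (hc : d c = 2) :
    Nat.card {κ : V → ℕ+ // IdentifiesOnlyPairs p κ ∧ colorContent κ = d} =
      ∑ i, Nat.card {κ : V → ℕ+ // (IdentifiesOnlyPairs p κ ∧ colorContent κ = d) ∧
        ∀ s, κ (p (i, s)) = c} := by
  classical
  have := fun i => finite_identifiesOnlyPairs p d fun κ => ∀ s, κ (p (i, s)) = c
  rw [← Nat.card_sigma]
  refine (Nat.card_congr (Equiv.ofBijective (fun q => ⟨q.2.1, q.2.2.1⟩) ⟨?_, ?_⟩)).symm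
  · rintro ⟨i, κ, ⟨h1, h2⟩, h3⟩ ⟨j, κ', h', h3'⟩ h
    obtain rfl : κ = κ' := congrArg Subtype.val h
    -- Two distinct pairs of color `c` would put at least three vertices in a color class of size 2.
    obtain rfl : i = j := by
      by_contra hij
      have hcard := colorContent_apply κ c
      rw [h2, hc] at hcard
      have hsub : ({p (i, false), p (i, true), p (j, false)} : Finset V) ⊆
          Finset.univ.filter fun v => κ v = c := by
        intro v hv
        simp only [Finset.mem_insert, Finset.mem_singleton] at hv
        rcases hv with rfl | rfl | rfl <;> simp [h3, h3']
      have := Finset.card_le_card hsub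
      rw [Finset.card_eq_three.2 ⟨_, _, _, ?_, ?_, ?_, rfl⟩] at this
      · lia
      all_goals exact fun h => by simpa [hij] using hp h
    rfl
  · rintro ⟨κ, h1, h2⟩
    have hcard := colorContent_apply κ c
    rw [h2, hc] at hcard
    obtain ⟨x, y, hxy, heq⟩ := Finset.card_eq_two.1 hcard.symm
    have hx : κ x = c := by
      have : x ∈ Finset.univ.filter fun v => κ v = c := by simp [heq]
      simpa using this
    have hy : κ y = c := by
      have : y ∈ Finset.univ.filter fun v => κ v = c := by simp [heq]
      simpa using this
    obtain ⟨i, s, rfl, rfl⟩ := h1 x y (hx.trans hy.symm) hxy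
    exact ⟨⟨i, κ, ⟨h1, h2⟩, fun s' => by cases s <;> cases s' <;> assumption⟩, rfl⟩

end RemovePair

/-- A color used twice occupies exactly one pair. Choosing that pair and deleting it with its color
lowers the number of doubled colors by one. -/
theorem card_identifiesOnlyPairs {ι V : Type*} [Fintype ι] [Fintype V] {p : ι × Bool → V}
    (hp : Function.Injective p) {d : ℕ+ →₀ ℕ} (hd : d.degree = Fintype.card V)
    (h2 : ∀ c, d c ≤ 2) :
    Nat.card {κ : V → ℕ+ // IdentifiesOnlyPairs p κ ∧ colorContent κ = d} =
      (Fintype.card ι).descFactorial (d.support.filter fun c => d c = 2).card *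
        (Fintype.card V - 2 * (d.support.filter fun c => d c = 2).card).factorial := by
  classical
  induction ht : (d.support.filter fun c => d c = 2).card generalizing ι V d with
  | zero =>
    have h1 : ∀ c, d c ≤ 1 := by
      intro c
      by_contra! h
      have hc : c ∈ d.support.filter fun c => d c = 2 := by
        have := h2 c
        rw [Finset.mem_filter, Finsupp.mem_support_iff]
        lia
      rw [Finset.card_eq_zero.1 ht] at hc
      exact Finset.notMem_empty _ hc
    simpa using card_identifiesOnlyPairs_of_le_one p hd h1
  | succ t ih =>
    obtain ⟨c, hcmem⟩ := Finset.card_pos.1 (ht.symm ▸ t.succ_pos : 0 < (d.support.filter fun c => d c = 2).card)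
    have hc : d c = 2 := (Finset.mem_filter.1 hcmem).2
    have herase : ((d.erase c).support.filter fun c' => d.erase c c' = 2).card = t := by
      have : (d.erase c).support.filter (fun c' => d.erase c c' = 2) =
          (d.support.filter fun c => d c = 2).erase c := by
        ext c'
        by_cases h : c' = c
        · simp [h]
        · simp [h, Finsupp.erase_ne h]
      rw [this, Finset.card_erase_of_mem hcmem, ht, Nat.add_sub_cancel]
    have hdeg : d.degree = (d.erase c).degree + 2 := by
      conv_lhs => rw [← Finsupp.erase_add_single c d, hc, map_add, Finsupp.degree_single]
    have hle : ∀ c', d.erase c c' ≤ 2 := by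
      intro c'
      rw [Finsupp.erase_apply]
      split_ifs
      exacts [by lia, h2 c']
    rw [card_identifiesOnlyPairs_eq_sum p hp hc]
    have hterm : ∀ i, Nat.card {κ : V → ℕ+ // (IdentifiesOnlyPairs p κ ∧ colorContent κ = d) ∧
        ∀ s, κ (p (i, s)) = c} = (Fintype.card ι - 1).descFactorial t *
          (Fintype.card V - 2 * (t + 1)).factorial := by
      intro i
      have hcardV := card_removePair p hp i
      rw [card_identifiesOnlyPairs_removePair p hp i hc,
        ih (removePair_injective p hp i) (by lia) hle herase]
      congr 2
      · rw [Fintype.card_subtype_compl, Fintype.card_subtype_eq]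
      · lia
    rw [Finset.sum_congr rfl fun i _ => hterm i, Finset.sum_const, Finset.card_univ, smul_eq_mul,
      ← mul_assoc]
    congr 1
    rcases Fintype.card ι with _ | n
    · simp
    · rw [Nat.add_sub_cancel, Nat.succ_descFactorial_succ]

/-! ### The e-expansion for complements of matchings. -/

theorem chromaticSymmetricFunction_eq_sum_of_pairs {ι V : Type*} [Fintype ι] [Fintype V]
    {G : SimpleGraph V} {p : ι × Bool → V} (hp : Function.Injective p)
    (hG : ∀ x y, x ≠ y → (¬ G.Adj x y ↔ ∃ i s, x = p (i, s) ∧ y = p (i, !s))) :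
    chromaticSymmetricFunction G = ∑ i ∈ Finset.range (Fintype.card ι + 1),
      (((Fintype.card ι).descFactorial i : ℚ) *
        matchingCoeff (Fintype.card V - 2 * i) (Fintype.card ι - i)) •
        (elemSymm (Fintype.card V - i) * elemSymm i) := by
  have hK : 2 * Fintype.card ι ≤ Fintype.card V := by
    have := Fintype.card_le_of_injective p hp
    rw [Fintype.card_prod, Fintype.card_bool] at this
    lia
  ext d
  have hcoeff : MvPowerSeries.coeff d (chromaticSymmetricFunction G) =
      Nat.card {κ : V → ℕ+ // IdentifiesOnlyPairs p κ ∧ colorContent κ = d} := by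
    change (Nat.card _ : ℚ) = _
    congr 1
    refine Nat.card_congr ⟨fun κ => ⟨κ.1, fun x y h hne => (hG x y hne).1 fun hadj =>
      κ.1.valid hadj h, κ.2⟩, fun κ => ⟨SimpleGraph.Coloring.mk κ.1 fun {x y} hadj h =>
      (hG x y hadj.ne).2 (κ.2.1 x y h hadj.ne) hadj, κ.2.2⟩, fun _ => rfl, fun _ => rfl⟩
  rw [hcoeff, map_sum]
  simp only [map_smul, smul_eq_mul]
  by_cases hd : d.degree = Fintype.card V ∧ ∀ c, d c ≤ 2
  · rw [card_identifiesOnlyPairs hp hd.1 hd.2, Nat.cast_mul,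
      ← sum_descFactorial_mul_matchingCoeff_ite hK]
    refine Finset.sum_congr rfl fun i hi => ?_
    have hi' := Finset.mem_range.1 hi
    have hsub : Fintype.card V - i + i = Fintype.card V := Nat.sub_add_cancel (by lia)
    rw [coeff_elemSymm_mul_elemSymm (hd.1.trans hsub.symm) hd.2, hsub]
  · rw [Finset.sum_eq_zero, Nat.cast_eq_zero]
    · have : IsEmpty {κ : V → ℕ+ // IdentifiesOnlyPairs p κ ∧ colorContent κ = d} := by
        refine ⟨fun ⟨κ, h1, h2⟩ => hd ⟨?_, fun c => ?_⟩⟩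
        · rw [← h2, degree_colorContent]
        · by_contra! h
          rw [← h2, colorContent_apply, Finset.two_lt_card_iff] at h
          obtain ⟨x, y, z, hx, hy, hz, hxy, hxz, hyz⟩ := h
          simp only [Finset.mem_filter, Finset.mem_univ, true_and] at hx hy hz
          -- Three vertices of one color are impossible, as `y` and `z` would both be the partner of
          -- `x`.
          obtain ⟨i, s, rfl, rfl⟩ := h1 x y (hx.trans hy.symm) hxy
          obtain ⟨j, t, h3, rfl⟩ := h1 _ z (hx.trans hz.symm) hxz
          obtain ⟨rfl, rfl⟩ := Prod.mk.inj (hp h3)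
          exact hyz rfl
      exact Nat.card_of_isEmpty
    · intro i hi
      have hi' := Finset.mem_range.1 hi
      rw [coeff_elemSymm_mul_elemSymm_eq_zero, mul_zero]
      rw [Nat.sub_add_cancel (by lia)]
      by_contra! h
      exact hd h

/-- Graphs whose complement is a matching are `e`-positive. -/
theorem graphEPositive_of_compl_matching {V : Type*} [Fintype V] {G : SimpleGraph V}
    (hG : ∀ a b c, a ≠ b → a ≠ c → ¬ G.Adj a b → ¬ G.Adj a c → b = c) : GraphEPositive G := by
  classical
  -- The pairs are the edges of the complement, each with an arbitrarily chosen orientation.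
  choose q hq using fun e : Gᶜ.edgeSet => show ∃ q : V × V, s(q.1, q.2) = e.1 from
    e.1.ind fun a b => ⟨(a, b), rfl⟩
  let p : Gᶜ.edgeSet × Bool → V := fun e => if e.2 then (q e.1).1 else (q e.1).2
  have hpe : ∀ e s, s(p (e, s), p (e, !s)) = e.1 := by
    rintro e (_ | _)
    · exact Sym2.eq_swap.trans (hq e)
    · exact hq e
  have hadj : ∀ e s, Gᶜ.Adj (p (e, s)) (p (e, !s)) := by
    intro e s
    have := e.2
    rwa [← hpe e s, SimpleGraph.mem_edgeSet] at this
  have hp : Function.Injective p := by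
    rintro ⟨e, s⟩ ⟨f, t⟩ h
    have h1 := hadj e s
    have h2 := hadj f t
    rw [SimpleGraph.compl_adj] at h1 h2
    rw [← h] at h2
    have h3 := hG _ _ _ h1.1 h2.1 h1.2 h2.2
    obtain rfl : e = f := by
      apply Subtype.ext
      rw [← hpe e s, ← hpe f t, h3, h]
    refine Prod.ext rfl ?_
    by_contra hst
    obtain rfl : s = !t := Bool.eq_not.2 hst
    exact (hadj e t).ne h.symm
  rw [GraphEPositive, chromaticSymmetricFunction_eq_sum_of_pairs hp]
  · refine EPositive.sum fun i hi => ?_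
    have hi' := Finset.mem_range.1 hi
    have hK := Fintype.card_le_of_injective p hp
    rw [Fintype.card_prod, Fintype.card_bool] at hK
    exact ((EPositive.elemSymm _).mul (EPositive.elemSymm _)).smul
      (mul_nonneg (Nat.cast_nonneg _) (matchingCoeff_nonneg (by lia)))
  · intro x y hxy
    constructor
    · intro h
      let e : Gᶜ.edgeSet := ⟨s(x, y), (SimpleGraph.compl_adj _ _ _).2 ⟨hxy, h⟩⟩
      have := hpe e true
      rcases Sym2.eq_iff.1 this with ⟨h1, h2⟩ | ⟨h1, h2⟩
      · exact ⟨e, true, h1.symm, h2.symm⟩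
      · exact ⟨e, false, h2.symm, h1.symm⟩
    · rintro ⟨e, s, rfl, rfl⟩
      exact ((SimpleGraph.compl_adj _ _ _).1 (hadj e s)).2

/-! ### Positivity in the two structural cases. -/

theorem GraphEPositive.of_split {V : Type*} [Fintype V] {G : SimpleGraph V} (P : V → Prop)
    [DecidablePred P] (hP : ∀ x y, P x → ¬ P y → ¬ G.Adj x y)
    (h₁ : GraphEPositive (G.comap (Subtype.val : {v // P v} → V)))
    (h₂ : GraphEPositive (G.comap (Subtype.val : {v // ¬ P v} → V))) : GraphEPositive G := by
  rw [GraphEPositive, chromaticSymmetricFunction_eq_mul G P hP]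
  exact EPositive.mul h₁ h₂

/-- The closed neighborhood of a vertex is a clique with no edges leaving it; split it off and
induct on the number of vertices. -/
theorem graphEPositive_of_adj_trans {V : Type*} [Fintype V] {G : SimpleGraph V}
    (hG : ∀ x y z, G.Adj x y → G.Adj y z → x ≠ z → G.Adj x z) : GraphEPositive G := by
  classical
  induction hn : Fintype.card V using Nat.strong_induction_on generalizing V with
  | _ n ih =>
    rcases isEmpty_or_nonempty V with hV | ⟨⟨v⟩⟩
    · exact graphEPositive_of_compl_matching fun a => hV.elim a
    · refine GraphEPositive.of_split (fun w => v = w ∨ G.Adj v w) ?_ ?_ ?_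
      · rintro x y (rfl | hx) hy hxy
        · exact hy (Or.inr hxy)
        · exact hy (or_iff_not_imp_left.2 fun h => hG _ _ _ hx hxy h)
      · refine graphEPositive_of_compl_matching fun a b _ hab _ h _ => absurd ?_ h
        have hab' : (a : V) ≠ b := fun h => hab (Subtype.ext h)
        rcases a with ⟨a, rfl | ha⟩ <;> rcases b with ⟨b, rfl | hb⟩
        · exact absurd rfl hab'
        · exact hb
        · exact ha.symm
        · exact hG _ _ _ ha.symm hb hab'
      · refine ih _ ?_ (fun x y z hxy hyz hxz => hG _ _ _ hxy hyz
          fun h => hxz (Subtype.ext h)) rfl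
        rw [← hn]
        exact Fintype.card_subtype_lt (x := v) fun h => h (Or.inl rfl)

theorem IsUnionOfCliques.graphEPositive {V : Type*} [Fintype V] {G : SimpleGraph V}
    (h : IsUnionOfCliques G) : GraphEPositive G :=
  graphEPositive_of_adj_trans fun x _ _ hxy hyz hxz =>
    h (G.connectedComponentMk x) rfl
      (SimpleGraph.ConnectedComponent.sound (hxy.reachable.trans hyz.reachable).symm) hxz

theorem IsCompleteMultipartitePlusVertex.graphEPositive {V : Type*} [Fintype V]
    {G : SimpleGraph V} (h : IsCompleteMultipartitePlusVertex G) : GraphEPositive G := by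
  classical
  obtain ⟨v, hv, hM, hα⟩ := h
  refine GraphEPositive.of_split (fun w => w ∈ ({v}ᶜ : Set V)) ?_ ?_ ?_
  · intro x y _ hy hxy
    obtain rfl : y = v := not_not.1 hy
    exact hv x hxy.symm
  · refine graphEPositive_of_compl_matching fun a b c hab hac h1 h2 => ?_
    -- Two distinct non-neighbors of `a` would form with it an independent set of size 3, so parts
    -- of size at most 2 make the complement a matching.
    by_contra hbc
    have h3 : ¬ (G.induce {v}ᶜ).Adj b c := hM.trans b a c (fun h => h1 h.symm) h2
    have hs : (G.induce {v}ᶜ).IsIndepSet (({a, b, c} : Finset _) : Set ↥({v}ᶜ : Set V)) := by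
      intro x hx y hy hxy
      have h1' : ¬ (G.induce {v}ᶜ).Adj a b := h1
      have h2' : ¬ (G.induce {v}ᶜ).Adj a c := h2
      simp only [Finset.coe_insert, Finset.coe_singleton, Set.mem_insert_iff,
        Set.mem_singleton_iff] at hx hy
      rcases hx with rfl | rfl | rfl <;> rcases hy with rfl | rfl | rfl <;>
        first | exact absurd rfl hxy | assumption | (rw [SimpleGraph.adj_comm]; assumption)
    have := hs.card_le_indepNum
    rw [Finset.card_eq_three.2 ⟨a, b, c, hab, hac, hbc, rfl⟩] at this
    lia
  · refine graphEPositive_of_compl_matching fun a b _ hab _ _ _ => absurd (Subtype.ext ?_) hab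
    exact (not_not.1 a.2 : (a : V) = v).trans (not_not.1 b.2 : (b : V) = v).symm

theorem mainTheorem8 {V : Type*} [Fintype V] (G : SimpleGraph V)
    (hdisc : ¬ G.Connected) (hclaw : InducedFree claw G) (hcod : InducedFree coDiamond G) :
    GraphEPositive G ∧ (IsUnionOfCliques G ∨ IsCompleteMultipartitePlusVertex G) := by
  have h := isUnionOfCliques_or_isCompleteMultipartitePlusVertex hdisc hclaw hcod
  exact ⟨h.elim IsUnionOfCliques.graphEPositive IsCompleteMultipartitePlusVertex.graphEPositive, h⟩
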